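/- **Model.** A base station with an $N$-antenna uniform linear array (spacing $d=\lambda_c/2$, $\lambda_c=c/f_c$), $M$ RF chains and $P$ sub-carriers $f_p=f_c+\frac{2p-P}{2P}B$, $p=1,\dots,P$ ($f_c,B,c>0$), serves $K$ users. User $k$ has $L_k\ge 1$ paths $(k,i)$ with complex gain $\alpha_{k,i}$, delay $\tau_{k,i}$, angle $\theta_{k,i}$ and distance $r_{k,i}$, and sends a nonzero pilot $s_k\in\mathbb C^T$, the same on all sub-carriers. Put $L=\sum_k L_k$ and $$b(\theta,r)=\tfrac1{\sqrt N}\Big[e^{-j\frac{2\pi}{\lambda_c}(r^{(n)}-r)}\Big]_{n=1}^N,\qquad r^{(n)}=\sqrt{r^2+(n-1)^2d^2-2r(n-1)d\sin\theta}.$$ The combining vectors $w_1,\dots,w_M\in\mathbb C^N$ have entries $e^{j\Phi_{mn}}$ with $\Phi_{mn}$ independent and uniform on $(0,2\pi)$. The noiseless received tensor $\mathcal Y\in\mathbb C^{P\times M\times T}$ has entries $$y_{p,m}[t]=w_m^H\sum_{k=1}^K h_{p,k}\,s_k[t],\qquad h_{p,k}=\sum_{i=1}^{L_k}\alpha_{k,i}e^{-j2\pi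 f_p\tau_{k,i}}\,b(\theta_{k,i},r_{k,i}).$$ Let $G=[G_1\cdots G_K]\in\mathbb C^{P\times L}$ have columns $[e^{-j2\pi f_p\tau_{k,i}}]_p$ and $A=[A_1\cdots A_K]\in\mathbb C^{M\times L}$ have columns $[\alpha_{k,i}w_m^Hb(\theta_{k,i},r_{k,i})]_m$, both partitioned by users; let $S_o=[s_1\cdots s_K]$, and let $S\in\mathbb C^{T\times L}$ have column $s_k$ for each path of user $k$. The k-rank $k_X$ of $X$ is the largest $r$ such that any $r$ columns of $X$ are linearly independent; the generalized k-rank $k'_X$ of a partitioned matrix is the largest $r$ such that the columns of any $r$ blocks together are linearly independent. A CPD of $\mathcal Y$ with $L$ terms is *essentially unique* if any other decomposition into $L$ nonzero rank-one terms has factor matrices $G\Lambda_1\Pi,\ A\Lambda_2\Pi,\ S\Lambda_3\Pi$ with diagonal $\Lambda_i$, $\Lambda_1\Lambda_2\Lambda_3=I$, and a permutation matrix $\Pi$. The block term decomposition (BTD) $\mathcal Y=\sum_k(G_kA_k^T)\circ s_k$ is *essentially unique* if its terms are rank-$(L_k,L_k,1)$ terms ($\operatorname{rank}G_k=\operatorname{rank}A_k=L_k$,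 $s_k\ne0$) and any other decomposition of $\mathcal Y$ into rank-$(L_k,L_k,1)$ terms, $k=1,\dots,K$, has factor matrices $G\Lambda_1\Pi,\ A\Lambda_2\Pi,\ S_o\Lambda_3\Pi_s$, where $\Lambda_1=\mathrm{blkdiag}(\Lambda_{1,k})$, $\Lambda_2=\mathrm{blkdiag}(\Lambda_{2,k})$ and $\Lambda_3=\mathrm{diag}(\lambda_k)$ are nonsingular with $\lambda_k\Lambda_{1,k}\Lambda_{2,k}^T=I_{L_k}$ for all $k$, $\Pi$ is a block permutation matrix, and $\Pi_s$ is the permutation matrix with the same pattern. **Claim.** 1. $\mathcal Y=\sum_{l=1}^L G_{:,l}\circ A_{:,l}\circ S_{:,l}=\sum_{k=1}^K(G_kA_k^T)\circ s_k$. 2. If $L_k\ge2$ for some $k$, then (for every realization of the combiner) the columns of $S$ belonging to the same user coincide, $k_S=1$, Kruskal's condition fails, i.e. $k_G+k_A+k_S<2L+2$, and, if $P,M\ge1$, the CPD is not essentially unique. 3. Let $T\ge2$ and let the pilots be pairwise linearly independent. Then $k_{S_o}\ge2$ if $K\ge2$. If moreover $PM\ge\sum_kL_k^2$, then for every realization of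 the combiner with $k'_G=k'_A=K$ the BTD is essentially unique, and $k'_G+k'_A+k_{S_o}\ge2K+2$ if $K\ge2$. In particular, if $k'_G=k'_A=K$ with probability one, then the BTD is essentially unique with probability one. 4. If $L\le P$, $L\le M$, the delays of all paths are pairwise distinct modulo $P/B$, all gains are nonzero, and the steering vectors of all $L$ paths are linearly independent, then $PM\ge\sum_kL_k^2$, $k'_G=K$, and $k'_A=K$ with probability one. Hence if, moreover, $T\ge2$ and the pilots are pairwise linearly independent, the BTD is essentially unique with probability one. -/

import Mathlib

open MeasureTheory ProbabilityTheory
open scoped Matrix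

noncomputable section

namespace NearField

/-! ### k-ranks -/

/-- The k-rank of a matrix: the largest `r` (at most the number of columns) such that any `r`
columns are linearly independent. -/
def kRank {m n : Type*} [Fintype n] (A : Matrix m n ℂ) : ℕ :=
  sSup {r : ℕ | r ≤ Fintype.card n ∧ ∀ s : Finset n, s.card = r →
    LinearIndependent ℂ (fun j : {j : n // j ∈ s} => fun i : m => A i j.1)}

/-- The generalized k-rank of a matrix whose columns are partitioned into `K` blocks, the `k`-th
one consisting of `L k` columns: the largest `r` (at most the number of blocks) such that the
columns of any `r` blocks, taken together, are linearly independent. -/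
def blockKRank {m : Type*} {K : ℕ} {L : Fin K → ℕ} (A : Matrix m (Σ k, Fin (L k)) ℂ) : ℕ :=
  sSup {r : ℕ | r ≤ K ∧ ∀ s : Finset (Fin K), s.card = r →
    LinearIndependent ℂ (fun j : {j : Σ k, Fin (L k) // j.1 ∈ s} => fun i : m => A i j.1)}

/-- The `k`-th block (submatrix) of a partitioned matrix. -/
def block {m : Type*} {K : ℕ} {L : Fin K → ℕ} (A : Matrix m (Σ k, Fin (L k)) ℂ) (k : Fin K) :
    Matrix m (Fin (L k)) ℂ :=
  Matrix.of fun i a => A i ⟨k, a⟩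

/-! ### Canonical polyadic decompositions -/

/-- `(A, B, C)` decomposes the tensor `Y` into rank-one terms, indexed by `Q`. -/
def IsCPD {Q : Type*} [Fintype Q] {I J T : ℕ} (A : Matrix (Fin I) Q ℂ) (B : Matrix (Fin J) Q ℂ)
    (C : Matrix (Fin T) Q ℂ) (Y : Fin I → Fin J → Fin T → ℂ) : Prop :=
  (∀ q, (fun i => A i q) ≠ 0 ∧ (fun j => B j q) ≠ 0 ∧ (fun t => C t q) ≠ 0) ∧
  ∀ i j t, Y i j t = ∑ q, A i q * B j q * C t q

/-- `(A', B', C')` arises from `(A, B, C)` by column scaling and column permutation. -/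
def CPDEquiv {Q : Type*} [Fintype Q] [DecidableEq Q] {I J T : ℕ}
    (A : Matrix (Fin I) Q ℂ) (B : Matrix (Fin J) Q ℂ) (C : Matrix (Fin T) Q ℂ)
    (A' : Matrix (Fin I) Q ℂ) (B' : Matrix (Fin J) Q ℂ) (C' : Matrix (Fin T) Q ℂ) : Prop :=
  ∃ (π : Equiv.Perm Q) (a b c : Q → ℂ),
    Matrix.diagonal a * Matrix.diagonal b * Matrix.diagonal c = (1 : Matrix Q Q ℂ) ∧
    A' = A * Matrix.diagonal a * π.permMatrix ℂ ∧
    B' = B * Matrix.diagonal b * π.permMatrix ℂ ∧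
    C' = C * Matrix.diagonal c * π.permMatrix ℂ

/-- Essential uniqueness of the CPD of `Y` with factor matrices `(A, B, C)`: every decomposition
of `Y` into the same number of rank-one terms arises from it by scaling and permutation. -/
def CPDUnique {Q : Type*} [Fintype Q] [DecidableEq Q] {I J T : ℕ}
    (A : Matrix (Fin I) Q ℂ) (B : Matrix (Fin J) Q ℂ) (C : Matrix (Fin T) Q ℂ)
    (Y : Fin I → Fin J → Fin T → ℂ) : Prop :=
  ∀ A' B' C', IsCPD A' B' C' Y → CPDEquiv A B C A' B' C'

/-! ### Block term decompositions -/

/-- `(A, B, C)` decomposes `Y` into `K` terms `(A_k B_kᵀ) ∘ c_k`, the `k`-th one being a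
rank-`(L k, L k, 1)` term. -/
def IsBTD {K : ℕ} {L : Fin K → ℕ} {I J T : ℕ}
    (A : Matrix (Fin I) (Σ k, Fin (L k)) ℂ) (B : Matrix (Fin J) (Σ k, Fin (L k)) ℂ)
    (C : Matrix (Fin T) (Fin K) ℂ) (Y : Fin I → Fin J → Fin T → ℂ) : Prop :=
  (∀ k, (block A k).rank = L k ∧ (block B k).rank = L k ∧ (fun t => C t k) ≠ 0) ∧
  ∀ i j t, Y i j t = ∑ k, (block A k * (block B k)ᵀ) i j * C t k

/-- The block permutation matrix with permutation pattern `π`; it is a permutation matrix when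
`L (π k) = L k` for all `k`. -/
def blockPermMatrix {K : ℕ} (L : Fin K → ℕ) (π : Equiv.Perm (Fin K)) :
    Matrix (Σ k, Fin (L k)) (Σ k, Fin (L k)) ℂ :=
  Matrix.of fun x y => if π x.1 = y.1 ∧ x.2.val = y.2.val then 1 else 0

/-- `(A', B', C')` arises from `(A, B, C)` by block scaling and block permutation:
`A' = A Λ_A Π`, `B' = B Λ_B Π`, `C' = C Λ_C Π_C` with nonsingular block diagonal `Λ_A`, `Λ_B`, and
nonsingular diagonal `Λ_C`, with `λ_k Λ_{A,k} Λ_{B,k}ᵀ = I` for all `k`, and with `Π`, `Π_C`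
sharing the same permutation pattern. -/
def BTDEquiv {K : ℕ} {L : Fin K → ℕ} {I J T : ℕ}
    (A : Matrix (Fin I) (Σ k, Fin (L k)) ℂ) (B : Matrix (Fin J) (Σ k, Fin (L k)) ℂ)
    (C : Matrix (Fin T) (Fin K) ℂ)
    (A' : Matrix (Fin I) (Σ k, Fin (L k)) ℂ) (B' : Matrix (Fin J) (Σ k, Fin (L k)) ℂ)
    (C' : Matrix (Fin T) (Fin K) ℂ) : Prop :=
  ∃ (π : Equiv.Perm (Fin K)) (a b : ∀ k, Matrix (Fin (L k)) (Fin (L k)) ℂ) (c : Fin K → ℂ),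
    (∀ k, L (π k) = L k) ∧
    (∀ k, IsUnit (a k) ∧ IsUnit (b k) ∧ c k ≠ 0 ∧ c k • (a k * (b k)ᵀ) = 1) ∧
    A' = A * Matrix.blockDiagonal' a * blockPermMatrix L π ∧
    B' = B * Matrix.blockDiagonal' b * blockPermMatrix L π ∧
    C' = C * Matrix.diagonal c * π.permMatrix ℂ

/-- `(A, B, C)` is a BTD of `Y` and it is essentially unique: every decomposition of `Y` into
rank-`(L k, L k, 1)` terms, `k = 1, …, K`, arises from it by block scaling and block
permutation. -/
def IsEssentiallyUniqueBTD {K : ℕ} {L : Fin K → ℕ} {I J T : ℕ}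
    (A : Matrix (Fin I) (Σ k, Fin (L k)) ℂ) (B : Matrix (Fin J) (Σ k, Fin (L k)) ℂ)
    (C : Matrix (Fin T) (Fin K) ℂ) (Y : Fin I → Fin J → Fin T → ℂ) : Prop :=
  IsBTD A B C Y ∧ ∀ A' B' C', IsBTD A' B' C' Y → BTDEquiv A B C A' B' C'

/-! ### The near-field uplink model -/

/-- The physical constants: carrier frequency, bandwidth and speed of light. -/
structure System where
  carrier : ℝ
  bandwidth : ℝ
  lightSpeed : ℝ
  carrier_pos : 0 < carrier
  bandwidth_pos : 0 < bandwidth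
  lightSpeed_pos : 0 < lightSpeed

/-- A propagation path: complex gain `α`, delay `τ`, angle `θ` and distance `r` (from the reference
antenna to the user or scatterer). -/
structure Path where
  gain : ℂ
  delay : ℝ
  angle : ℝ
  dist : ℝ

/-- The carrier wavelength. -/
def System.wavelength (sys : System) : ℝ := sys.lightSpeed / sys.carrier

/-- The antenna spacing: half a wavelength. -/
def System.spacing (sys : System) : ℝ := sys.wavelength / 2

/-- The frequency of the `p`-th of `P` sub-carriers, `f_c + (2p - P) / (2P) * B` for
`p = 1, …, P`; here the index `p : Fin P` starts at `0`. -/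
def System.freq (sys : System) (P : ℕ) (p : Fin P) : ℝ :=
  sys.carrier + (2 * ((p : ℝ) + 1) - P) / (2 * P) * sys.bandwidth

/-- The distance from a point at angle `θ` and distance `r` (from the first antenna) to the `n`-th
antenna; the index `n` starts at `0`. -/
def System.antennaDist (sys : System) (n : ℕ) (θ r : ℝ) : ℝ :=
  Real.sqrt (r ^ 2 + (n : ℝ) ^ 2 * sys.spacing ^ 2 - 2 * r * n * sys.spacing * Real.sin θ)

/-- The near-field steering vector `b(θ, r) ∈ ℂ^N` of the uniform linear array. -/
def System.steering (sys : System) (N : ℕ) (θ r : ℝ) : Fin N → ℂ := fun n =>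
  (1 / Real.sqrt N : ℝ) * Complex.exp
    (-Complex.I * ((2 * Real.pi / sys.wavelength * (sys.antennaDist n θ r - r) : ℝ) : ℂ))

/-- The frequency-domain response `exp(-j 2π f_p τ)` of a delay `τ` on the `p`-th sub-carrier. -/
def System.delayResponse (sys : System) (P : ℕ) (τ : ℝ) (p : Fin P) : ℂ :=
  Complex.exp (-Complex.I * ((2 * Real.pi * sys.freq P p * τ : ℝ) : ℂ))

/-- The channel `h_{p,k} ∈ ℂ^N` of a user with `l` paths at the `p`-th sub-carrier. -/
def System.channel (sys : System) (N P : ℕ) {l : ℕ} (path : Fin l → Path) (p : Fin P) :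
    Fin N → ℂ :=
  ∑ i, ((path i).gain * sys.delayResponse P (path i).delay p) •
    sys.steering N (path i).angle (path i).dist

/-- The phase-only combining vectors: `w m n = exp(j φ m n)`. -/
def combiner {M N : ℕ} (φ : Fin M → Fin N → ℝ) (m : Fin M) : Fin N → ℂ := fun n =>
  Complex.exp (Complex.I * (φ m n : ℂ))

section Model

variable {K : ℕ} {L : Fin K → ℕ}

/-- The noiseless received tensor: entry `(p, m, t)` is `w_mᴴ ∑_k h_{p,k} s_k[t]`. -/
def received (sys : System) {N M T : ℕ} (P : ℕ) (path : ∀ k, Fin (L k) → Path)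
    (w : Fin M → Fin N → ℂ) (s : Fin K → Fin T → ℂ) : Fin P → Fin M → Fin T → ℂ := fun p m t =>
  star (w m) ⬝ᵥ ∑ k, s k t • sys.channel N P (path k) p

/-- The delay factor matrix `G = [G_1 ⋯ G_K]`, with one column `g(τ_{k,i})` for each path. -/
def delayMatrix (sys : System) (P : ℕ) (path : ∀ k, Fin (L k) → Path) :
    Matrix (Fin P) (Σ k, Fin (L k)) ℂ :=
  Matrix.of fun p l => sys.delayResponse P (path l.1 l.2).delay p

/-- The spatial factor matrix `A = [A_1 ⋯ A_K]`, whose entry at RF chain `m` and path `l` is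
`α_l w_mᴴ b(θ_l, r_l)`. -/
def spatialMatrix (sys : System) {N M : ℕ} (path : ∀ k, Fin (L k) → Path)
    (w : Fin M → Fin N → ℂ) : Matrix (Fin M) (Σ k, Fin (L k)) ℂ :=
  Matrix.of fun m l => (path l.1 l.2).gain *
    (star (w m) ⬝ᵥ sys.steering N (path l.1 l.2).angle (path l.1 l.2).dist)

/-- The pilot matrix `S_o = [s_1 ⋯ s_K]`, with one column for each user. -/
def pilotMatrix {T : ℕ} (s : Fin K → Fin T → ℂ) : Matrix (Fin T) (Fin K) ℂ :=
  Matrix.of fun t k => s k t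

/-- The binary matrix `O` that associates each path with its user. -/
def userMatrix (L : Fin K → ℕ) : Matrix (Fin K) (Σ k, Fin (L k)) ℂ :=
  Matrix.of fun k l => if l.1 = k then 1 else 0

/-- The pilot factor matrix `S = S_o O` of the CPD model, with one column for each path. -/
def pathPilotMatrix (L : Fin K → ℕ) {T : ℕ} (s : Fin K → Fin T → ℂ) :
    Matrix (Fin T) (Σ k, Fin (L k)) ℂ :=
  pilotMatrix s * userMatrix L

end Model

end NearField

end

/-!
The combining vectors do not depend on the sub-carrier, and the pilot of a user is shared by all of
its paths. Hence the received tensor is a sum of one rank-one term per path, and the terms of the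
same user have the same third factor.

*Failure of the CPD model.* Two paths of one user give equal columns of `S`, so `kRank S = 1`, and
Kruskal's condition fails because the other two k-ranks are at most `L`. The two corresponding terms
`u ∘ v ∘ s + u' ∘ v' ∘ s` equal `u ∘ (v + c v') ∘ s + (u' - c u) ∘ v' ∘ s` for every `c`, and a
generic `c` produces a rank-one term that does not occur in the original decomposition. If some
column of `A` vanishes, then any decomposition into `L` nonzero terms is inequivalent to the given
one, and one exists (`not_cpdUnique`).

*Uniqueness of the BTD.* The generalized k-rank equals `K` exactly when all columns are independent
(`blockKRank_eq_iff`), so `G` and `A` have left inverses. Contracting the third mode against a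
vector `x` turns two decompositions into factorizations `G D(x) Aᵀ = G' D'(x) A'ᵀ` whose middle
factors are diagonal and constant on blocks. If `D(x₀)` is invertible, then
`G' = G X` and `A' = A Z` with `X`, `Z` invertible and `X D'(x) Zᵀ = D(x)` for all `x`
(`exists_baseChange`). Consequently `D(x₁) D(x₀)⁻¹ X = X D'(x₁) D'(x₀)⁻¹`, and similarly for `Z`.
The pilots being pairwise independent, `x₀` and `x₁` can be chosen such that the `K` diagonal blocks
of `D(x₁) D(x₀)⁻¹` are distinct scalars. Each block row and each block column of `X` then has exactly
one nonzero block, which is the asserted equivalence (`IsBTD.btdEquiv`).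

*Generic full rank.* Up to column scaling `G` is a Vandermonde matrix, with distinct nodes when the
delays are distinct modulo `P / B`. The matrix `A` is the product of the conjugated combiner with a
matrix of full column rank. A minor of maximal size of this product is a nonzero polynomial in the
entries of the combiner, which are independent with atomless laws, so that it almost surely does not
vanish (`ae_linearIndependent_col_mul`).
-/

namespace NearField

/-! ### k-ranks -/

/-- The generalized k-rank is maximal exactly when the matrix has full column rank. -/
theorem blockKRank_eq_iff {m : Type*} {K : ℕ} {L : Fin K → ℕ}
    (A : Matrix m (Σ k, Fin (L k)) ℂ) :
    blockKRank A = K ↔ LinearIndependent ℂ A.col := by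
  set R : Set ℕ := {r : ℕ | r ≤ K ∧ ∀ s : Finset (Fin K), s.card = r →
    LinearIndependent ℂ (fun j : {j : Σ k, Fin (L k) // j.1 ∈ s} => fun i : m => A i j.1)}
  have hbdd : BddAbove R := ⟨K, fun r hr => hr.1⟩
  have hne : R.Nonempty := by
    refine ⟨0, Nat.zero_le _, fun s hs => ?_⟩
    rw [Finset.card_eq_zero] at hs
    subst hs
    have : IsEmpty {j : Σ k, Fin (L k) // j.1 ∈ (∅ : Finset (Fin K))} :=
      ⟨fun j => Finset.notMem_empty _ j.2⟩
    exact linearIndependent_empty_type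
  constructor
  · intro h
    have hmem : K ∈ R := by
      have := Nat.sSup_mem hne hbdd
      rwa [show sSup R = K from h] at this
    have h2 := hmem.2 Finset.univ (by simp)
    exact h2.comp (fun q => ⟨q, Finset.mem_univ _⟩) fun p q hpq => by simpa using hpq
  · intro h
    refine le_antisymm (csSup_le hne fun r hr => hr.1) (le_csSup hbdd ⟨le_rfl, fun s _ => ?_⟩)
    exact h.comp (fun j : {j : Σ k, Fin (L k) // j.1 ∈ s} => j.1) Subtype.val_injective

theorem kRank_le {m n : Type*} [Fintype n] (A : Matrix m n ℂ) {b : ℕ}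
    (h : ∀ r ≤ Fintype.card n, (∀ s : Finset n, s.card = r →
      LinearIndependent ℂ (fun j : {j : n // j ∈ s} => fun i : m => A i j.1)) → r ≤ b) :
    kRank A ≤ b := by
  refine csSup_le ⟨0, Nat.zero_le _, fun s hs => ?_⟩ fun r hr => h r hr.1 hr.2
  rw [Finset.card_eq_zero] at hs
  subst hs
  have : IsEmpty {j : n // j ∈ (∅ : Finset n)} := ⟨fun j => Finset.notMem_empty _ j.2⟩
  exact linearIndependent_empty_type

theorem kRank_le_card {m n : Type*} [Fintype n] (A : Matrix m n ℂ) :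
    kRank A ≤ Fintype.card n :=
  kRank_le A fun _ hr _ => hr

theorem le_kRank {m n : Type*} [Fintype n] (A : Matrix m n ℂ) {r : ℕ} (hr : r ≤ Fintype.card n)
    (h : ∀ s : Finset n, s.card = r →
      LinearIndependent ℂ (fun j : {j : n // j ∈ s} => fun i : m => A i j.1)) :
    r ≤ kRank A :=
  le_csSup ⟨Fintype.card n, fun _ hr => hr.1⟩ ⟨hr, h⟩

theorem two_le_kRank {m n : Type*} [Fintype n] (A : Matrix m n ℂ) (hn : 2 ≤ Fintype.card n)
    (h : ∀ i j, i ≠ j → LinearIndependent ℂ ![A.col i, A.col j]) : 2 ≤ kRank A := by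
  classical
  refine le_kRank A hn fun s hs => ?_
  obtain ⟨x, y, hxy, rfl⟩ := Finset.card_eq_two.1 hs
  have h' := h x y hxy
  let e : {j : n // j ∈ ({x, y} : Finset n)} → Fin 2 := fun j => if j.1 = x then 0 else 1
  have he : Function.Injective e := by
    rintro ⟨a, ha⟩ ⟨b, hb⟩ hab
    simp only [Finset.mem_insert, Finset.mem_singleton] at ha hb
    rcases ha with rfl | rfl <;> rcases hb with rfl | rfl <;> simp_all [e]
  convert h'.comp e he using 1
  funext j
  obtain ⟨a, ha⟩ := j
  simp only [Finset.mem_insert, Finset.mem_singleton] at ha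
  rcases ha with rfl | rfl
  · ext i; simp [e, Matrix.col]
  · ext i; simp [e, Matrix.col, hxy.symm]

theorem kRank_eq_one {m n : Type*} [Fintype n] (A : Matrix m n ℂ) (h0 : ∀ j, A.col j ≠ 0)
    {x y : n} (hxy : x ≠ y) (h : A.col x = A.col y) : kRank A = 1 := by
  classical
  apply le_antisymm
  · refine kRank_le A fun r hr hind => ?_
    by_contra! hr1
    obtain ⟨s, hs, hcard⟩ := Finset.exists_superset_card_eq (s := {x, y}) (n := r)
      (by rw [Finset.card_pair hxy]; omega) hr
    have hx : x ∈ s := hs (by simp)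
    have hy : y ∈ s := hs (by simp)
    have := (hind s hcard).injective (a₁ := ⟨x, hx⟩) (a₂ := ⟨y, hy⟩) h
    exact hxy (by simpa using this)
  · refine le_kRank A (Fintype.card_pos_iff.2 ⟨x⟩) fun s hs => ?_
    obtain ⟨z, rfl⟩ := Finset.card_eq_one.1 hs
    let : Unique {j : n // j ∈ ({z} : Finset n)} :=
      ⟨⟨⟨z, by simp⟩⟩, fun j => Subtype.ext (Finset.mem_singleton.1 j.2)⟩
    exact linearIndependent_unique_iff.2 (h0 _)

/-! ### Linear algebra for the block term decomposition -/

theorem exists_mul_eq_one_of_linearIndependent_col {m n : Type*} [Fintype m] [Fintype n]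
    [DecidableEq n] {A : Matrix m n ℂ} (hA : LinearIndependent ℂ A.col) :
    ∃ B : Matrix n m ℂ, B * A = 1 := by
  classical
  obtain ⟨g, hg⟩ := A.mulVecLin.exists_leftInverse_of_injective
    (LinearMap.ker_eq_bot.2 (Matrix.mulVec_injective_iff.2 hA))
  refine ⟨LinearMap.toMatrix' g, ?_⟩
  have := congrArg LinearMap.toMatrix' hg
  rwa [LinearMap.toMatrix'_comp, LinearMap.toMatrix'_id, ← Matrix.toLin'_apply',
    LinearMap.toMatrix'_toLin'] at this

theorem linearIndependent_col_of_mul_eq_one {m n : Type*} [Fintype m] [Fintype n]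
    [DecidableEq n] {A : Matrix m n ℂ} {B : Matrix n m ℂ} (h : B * A = 1) :
    LinearIndependent ℂ A.col := by
  rw [← Matrix.mulVec_injective_iff]
  intro x y hxy
  have := congrArg (B *ᵥ ·) hxy
  simpa [Matrix.mulVec_mulVec, h] using this

/-- If `X` and `Zᵀ` carry two diagonal matrices to two diagonal matrices, then `X` intertwines the
ratios of the diagonals, so that a nonzero entry of `X` forces the corresponding ratios to agree. -/
theorem ratio_eq_of_mul_diagonal_mul {n : Type*} [Fintype n] [DecidableEq n] {X Z : Matrix n n ℂ}
    {d₀ d₁ e₀ e₁ : n → ℂ} (hd : ∀ i, d₀ i ≠ 0)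
    (h₀ : X * Matrix.diagonal e₀ * Zᵀ = Matrix.diagonal d₀)
    (h₁ : X * Matrix.diagonal e₁ * Zᵀ = Matrix.diagonal d₁) (he : ∀ i, e₀ i ≠ 0)
    {p q : n} (hpq : X p q ≠ 0) : d₁ p / d₀ p = e₁ q / e₀ q := by
  have hD : Matrix.diagonal d₀ * Matrix.diagonal (fun i => (d₀ i)⁻¹) = 1 := by
    simp [Matrix.diagonal_mul_diagonal, hd]
  have hE : Matrix.diagonal e₁ = Matrix.diagonal (fun i => e₁ i / e₀ i) * Matrix.diagonal e₀ := by
    simp [Matrix.diagonal_mul_diagonal, he]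
  have hW : (Matrix.diagonal e₀ * Zᵀ * Matrix.diagonal (fun i => (d₀ i)⁻¹)) * X = 1 := by
    rw [mul_eq_one_comm, ← Matrix.mul_assoc, ← Matrix.mul_assoc, h₀, hD]
  have key : Matrix.diagonal (fun i => d₁ i / d₀ i) * X
      = X * Matrix.diagonal (fun i => e₁ i / e₀ i) := by
    calc Matrix.diagonal (fun i => d₁ i / d₀ i) * X
        = X * Matrix.diagonal e₁ * Zᵀ * Matrix.diagonal (fun i => (d₀ i)⁻¹) * X := by
          rw [h₁]; simp [Matrix.diagonal_mul_diagonal, div_eq_mul_inv]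
      _ = X * Matrix.diagonal (fun i => e₁ i / e₀ i) *
            ((Matrix.diagonal e₀ * Zᵀ * Matrix.diagonal (fun i => (d₀ i)⁻¹)) * X) := by
          rw [hE]; simp only [Matrix.mul_assoc]
      _ = _ := by rw [hW, Matrix.mul_one]
  have := congrFun (congrFun key p) q
  rw [Matrix.diagonal_mul, Matrix.mul_diagonal, mul_comm] at this
  exact mul_left_cancel₀ hpq this

/-- Contracting the third mode of a sum of block terms against `x` gives a matrix product with a
diagonal middle factor that is constant on each block. -/
theorem mul_diagonal_mul_transpose_eq {K : ℕ} {L : Fin K → ℕ} {I J T : ℕ}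
    {A : Matrix (Fin I) (Σ k, Fin (L k)) ℂ} {B : Matrix (Fin J) (Σ k, Fin (L k)) ℂ}
    {C : Matrix (Fin T) (Fin K) ℂ} {Y : Fin I → Fin J → Fin T → ℂ}
    (h : ∀ i j t, Y i j t = ∑ k, (block A k * (block B k)ᵀ) i j * C t k) (x : Fin T → ℂ) :
    A * Matrix.diagonal (fun q : Σ k, Fin (L k) => (x ᵥ* C) q.1) * Bᵀ =
      Matrix.of fun i j => ∑ t, x t * Y i j t := by
  ext i j
  rw [Matrix.mul_apply]
  simp only [Matrix.mul_diagonal, Matrix.transpose_apply, Matrix.of_apply, h, block,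
    Matrix.vecMul, dotProduct, Fintype.sum_sigma, Finset.mul_sum, Finset.sum_mul,
    Matrix.mul_apply (l := Fin I) (m := Fin _)]
  rw [Finset.sum_comm (s := (Finset.univ : Finset (Fin T)))]
  refine Finset.sum_congr rfl fun k _ => ?_
  rw [Finset.sum_comm]
  refine Finset.sum_congr rfl fun t _ => Finset.sum_congr rfl fun a _ => by ring

/-- A family of pairwise independent vectors (all nonzero) admits two linear functionals, the first
nonvanishing on the family, whose ratio separates its members. -/
theorem exists_vecMul_separating {T K : ℕ} (C : Matrix (Fin T) (Fin K) ℂ)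
    (h0 : ∀ k, C.col k ≠ 0)
    (hC : ∀ i j, i ≠ j → LinearIndependent ℂ ![C.col i, C.col j]) :
    ∃ x₀ x₁ : Fin T → ℂ, (∀ k, (x₀ ᵥ* C) k ≠ 0) ∧
      Function.Injective fun k => (x₁ ᵥ* C) k / (x₀ ᵥ* C) k := by
  -- vectors can be chosen off finitely many hyperplanes
  have avoid : ∀ {ι : Type} [Finite ι] (v : ι → Fin T → ℂ), (∀ i, v i ≠ 0) →
      ∃ x : Fin T → ℂ, ∀ i, x ⬝ᵥ v i ≠ 0 := by
    intro ι _ v hv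
    obtain ⟨f, hf⟩ := Module.exists_dual_forall_apply_ne_zero (K := ℂ) v hv
    refine ⟨fun t => f (Pi.single t 1), fun i => ?_⟩
    have : f (v i) = (fun t => f (Pi.single t 1)) ⬝ᵥ v i := by
      conv_lhs => rw [pi_eq_sum_univ' (v i)]
      simp [dotProduct, mul_comm]
    rw [← this]
    exact hf i
  obtain ⟨x₀, hx₀⟩ := avoid (fun k => C.col k) h0
  -- `x₁` separates the ratios at `i` and `j` if it is off the hyperplane of this combination
  obtain ⟨x₁, hx₁⟩ := avoid (fun p : {p : Fin K × Fin K // p.1 ≠ p.2} =>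
    (x₀ ⬝ᵥ C.col p.1.2) • C.col p.1.1 - (x₀ ⬝ᵥ C.col p.1.1) • C.col p.1.2) (by
      rintro ⟨⟨i, j⟩, hij⟩ h
      have := LinearIndependent.pair_iff.1 (hC i j hij) (x₀ ⬝ᵥ C.col j) (-(x₀ ⬝ᵥ C.col i))
        (by rw [neg_smul, ← sub_eq_add_neg]; exact h)
      exact hx₀ j this.1)
  refine ⟨x₀, x₁, hx₀, fun i j hij => ?_⟩
  by_contra hne
  have h1 := hx₁ ⟨(i, j), hne⟩
  apply h1
  have h2 : x₁ ⬝ᵥ C.col i / x₀ ⬝ᵥ C.col i = x₁ ⬝ᵥ C.col j / x₀ ⬝ᵥ C.col j := hij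
  rw [div_eq_div_iff (hx₀ i) (hx₀ j)] at h2
  simp only [dotProduct_sub, dotProduct_smul, smul_eq_mul]
  linear_combination h2

/-- A square matrix supported on the blocks `(k, π k)` of a partitioned index set, with `π`
preserving the block sizes, factors as a block diagonal matrix times a block permutation matrix. -/
theorem eq_blockDiagonal'_mul_blockPermMatrix {K : ℕ} {L : Fin K → ℕ} (π : Equiv.Perm (Fin K))
    (hπ : ∀ k, L (π k) = L k) (X : Matrix (Σ k, Fin (L k)) (Σ k, Fin (L k)) ℂ)
    (hX : ∀ p q, X p q ≠ 0 → q.1 = π p.1) :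
    X = Matrix.blockDiagonal' (fun k => Matrix.of fun i j : Fin (L k) =>
      X ⟨k, i⟩ ⟨π k, Fin.cast (hπ k).symm j⟩) * blockPermMatrix L π := by
  ext ⟨k, i⟩ ⟨l, j⟩
  obtain ⟨l, rfl⟩ := π.surjective l
  rw [Matrix.mul_apply, Finset.sum_eq_single ⟨l, Fin.cast (hπ l) j⟩]
  · by_cases hkl : k = l
    · subst hkl
      simp [blockPermMatrix, Matrix.blockDiagonal'_apply]
    · rw [Matrix.blockDiagonal'_apply_ne _ _ _ hkl, zero_mul]
      by_contra h
      exact hkl (π.injective (hX _ _ h)).symm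
  · rintro ⟨m, j'⟩ - hne
    have : ¬ (π m = π l ∧ j'.val = j.val) := by
      rintro ⟨h1, h2⟩
      obtain rfl := π.injective h1
      exact hne (by congr; ext; simpa using h2)
    rw [blockPermMatrix, Matrix.of_apply, if_neg this, mul_zero]
  · simp

/-- If an invertible matrix is supported on the blocks `(σ l, l)` with `σ` a permutation, then the
blocks are square. -/
theorem card_eq_of_support {K : ℕ} {L : Fin K → ℕ} (σ : Equiv.Perm (Fin K))
    {X W : Matrix (Σ k, Fin (L k)) (Σ k, Fin (L k)) ℂ} (hW : W * X = 1)
    (hX : ∀ p q, X p q ≠ 0 → p.1 = σ q.1) (l : Fin K) : L (σ l) = L l := by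
  have hle : ∀ l, L l ≤ L (σ l) := by
    intro l
    -- as `X` vanishes elsewhere in this block column, the block `(l, σ l)`
    -- of `W` is a left inverse of the block `(σ l, l)` of `X`
    have h1 : (Matrix.of fun (i : Fin (L l)) (j : Fin (L (σ l))) => W ⟨l, i⟩ ⟨σ l, j⟩) *
        (Matrix.of fun (j : Fin (L (σ l))) (i : Fin (L l)) => X ⟨σ l, j⟩ ⟨l, i⟩) = 1 := by
      ext i i'
      have h2 := congrFun (congrFun hW ⟨l, i⟩) ⟨l, i'⟩
      rw [Matrix.mul_apply, Fintype.sum_sigma, Finset.sum_eq_single (σ l)] at h2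
      · simpa [Matrix.mul_apply, Matrix.one_apply] using h2
      · intro k _ hk
        refine Finset.sum_eq_zero fun j _ => ?_
        have : X ⟨k, j⟩ ⟨l, i'⟩ = 0 := by
          by_contra h
          exact hk (hX _ _ h)
        rw [this, mul_zero]
      · simp
    simpa using (linearIndependent_col_of_mul_eq_one h1).fintype_card_le_finrank
  have hsum : ∑ l, L l = ∑ l, L (σ l) := (Equiv.sum_comp σ L).symm
  exact ((Finset.sum_eq_sum_iff_of_le fun l _ => hle l).1 hsum l (Finset.mem_univ l)).symm

theorem rank_block_eq {m K : ℕ} {L : Fin K → ℕ} {A : Matrix (Fin m) (Σ k, Fin (L k)) ℂ}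
    (hA : LinearIndependent ℂ A.col) (k : Fin K) : (block A k).rank = L k := by
  have : LinearIndependent ℂ (block A k).col :=
    hA.comp (fun a => (⟨k, a⟩ : Σ k, Fin (L k))) (fun a b h => by simpa using h)
  rw [← Matrix.rank_transpose]
  simpa using LinearIndependent.rank_matrix (M := (block A k)ᵀ) this

/-! ### Uniqueness of the block term decomposition -/

/-- Two simultaneous factorizations of a family of matrices through diagonal middle factors, the
second one with full column rank outer factors and with some invertible middle factor: the outer
factors of the first are obtained from those of the second by invertible base changes. -/
theorem exists_baseChange {I J n ι : Type*} [Fintype I] [Fintype J] [Fintype n] [DecidableEq n]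
    {A A' : Matrix I n ℂ} {B B' : Matrix J n ℂ} (hA : LinearIndependent ℂ A.col)
    (hB : LinearIndependent ℂ B.col) (d d' : ι → n → ℂ)
    (hY : ∀ x, A' * Matrix.diagonal (d' x) * B'ᵀ = A * Matrix.diagonal (d x) * Bᵀ)
    {x₀ : ι} (hx₀ : ∀ q, d x₀ q ≠ 0) :
    ∃ X Z : Matrix n n ℂ, A' = A * X ∧ B' = B * Z ∧ IsUnit X.det ∧ (∀ q, d' x₀ q ≠ 0) ∧
      ∀ x, X * Matrix.diagonal (d' x) * Zᵀ = Matrix.diagonal (d x) := by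
  obtain ⟨GA, hGA⟩ := exists_mul_eq_one_of_linearIndependent_col hA
  obtain ⟨GB, hGB⟩ := exists_mul_eq_one_of_linearIndependent_col hB
  have hGA' : Aᵀ * GAᵀ = 1 := by rw [← Matrix.transpose_mul, hGA, Matrix.transpose_one]
  have hGB' : Bᵀ * GBᵀ = 1 := by rw [← Matrix.transpose_mul, hGB, Matrix.transpose_one]
  obtain ⟨X, hXdef⟩ : ∃ X, X = GA * A' := ⟨_, rfl⟩
  obtain ⟨Z, hZdef⟩ : ∃ Z, Z = GB * B' := ⟨_, rfl⟩
  have hXT : Xᵀ = A'ᵀ * GAᵀ := by rw [hXdef, Matrix.transpose_mul]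
  have hZT : Zᵀ = B'ᵀ * GBᵀ := by rw [hZdef, Matrix.transpose_mul]
  have hXZ : ∀ x, X * Matrix.diagonal (d' x) * Zᵀ = Matrix.diagonal (d x) := by
    intro x
    calc X * Matrix.diagonal (d' x) * Zᵀ
        = GA * (A' * Matrix.diagonal (d' x) * B'ᵀ) * GBᵀ := by
          rw [hXdef, hZT]; simp only [Matrix.mul_assoc]
      _ = (GA * A) * Matrix.diagonal (d x) * (Bᵀ * GBᵀ) := by
          rw [hY]; simp only [Matrix.mul_assoc]
      _ = _ := by rw [hGA, hGB', Matrix.one_mul, Matrix.mul_one]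
  have hdet : X.det * (Matrix.diagonal (d' x₀)).det * Z.det ≠ 0 := by
    rw [← Matrix.det_transpose Z, ← Matrix.det_mul, ← Matrix.det_mul, hXZ, Matrix.det_diagonal]
    exact Finset.prod_ne_zero_iff.2 fun q _ => hx₀ q
  have hXu : IsUnit X.det := (left_ne_zero_of_mul (left_ne_zero_of_mul hdet)).isUnit
  have hdu : (Matrix.diagonal (d' x₀)).det ≠ 0 := right_ne_zero_of_mul (left_ne_zero_of_mul hdet)
  have hZu : IsUnit Z.det := (right_ne_zero_of_mul hdet).isUnit
  refine ⟨X, Z, ?_, ?_, hXu, fun q =>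
    Finset.prod_ne_zero_iff.1 (Matrix.det_diagonal.symm.trans_ne hdu) q (Finset.mem_univ q), hXZ⟩
  · have h1 : A' * (Matrix.diagonal (d' x₀) * Zᵀ) = A * X * (Matrix.diagonal (d' x₀) * Zᵀ) := by
      calc A' * (Matrix.diagonal (d' x₀) * Zᵀ)
          = (A' * Matrix.diagonal (d' x₀) * B'ᵀ) * GBᵀ := by
            rw [hZT]; simp only [Matrix.mul_assoc]
        _ = A * Matrix.diagonal (d x₀) * (Bᵀ * GBᵀ) := by rw [hY]; simp only [Matrix.mul_assoc]
        _ = A * (X * Matrix.diagonal (d' x₀) * Zᵀ) := by rw [hGB', hXZ, Matrix.mul_one]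
        _ = _ := by simp only [Matrix.mul_assoc]
    refine Matrix.mul_left_injective_of_inv _ _
      (Matrix.mul_nonsing_inv (Matrix.diagonal (d' x₀) * Zᵀ) ?_) h1
    rw [Matrix.det_mul, Matrix.det_transpose]
    exact hdu.isUnit.mul hZu
  · have h1 : (X * Matrix.diagonal (d' x₀)) * B'ᵀ = (X * Matrix.diagonal (d' x₀)) * (B * Z)ᵀ := by
      calc (X * Matrix.diagonal (d' x₀)) * B'ᵀ
          = GA * (A' * Matrix.diagonal (d' x₀) * B'ᵀ) := by
            rw [hXdef]; simp only [Matrix.mul_assoc]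
        _ = (GA * A) * Matrix.diagonal (d x₀) * Bᵀ := by rw [hY]; simp only [Matrix.mul_assoc]
        _ = (X * Matrix.diagonal (d' x₀) * Zᵀ) * Bᵀ := by rw [hGA, hXZ, Matrix.one_mul]
        _ = _ := by rw [Matrix.transpose_mul]; simp only [Matrix.mul_assoc]
    refine Matrix.transpose_injective (Matrix.mul_right_injective_of_inv _ _
      (Matrix.nonsing_inv_mul (X * Matrix.diagonal (d' x₀)) ?_) h1)
    rw [Matrix.det_mul]
    exact hXu.mul hdu.isUnit

/-- Base changes supported on the blocks `(k, π k)` of a block permutation pattern make two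
factorizations with block-scalar middle factors equivalent as block term decompositions. -/
theorem btdEquiv_of_support {K : ℕ} {L : Fin K → ℕ} {I J T : ℕ} (hL : ∀ k, 1 ≤ L k)
    {A : Matrix (Fin I) (Σ k, Fin (L k)) ℂ} {B : Matrix (Fin J) (Σ k, Fin (L k)) ℂ}
    {C : Matrix (Fin T) (Fin K) ℂ} {A' : Matrix (Fin I) (Σ k, Fin (L k)) ℂ}
    {B' : Matrix (Fin J) (Σ k, Fin (L k)) ℂ} {C' : Matrix (Fin T) (Fin K) ℂ}
    {X Z : Matrix (Σ k, Fin (L k)) (Σ k, Fin (L k)) ℂ} (hAX : A' = A * X) (hBZ : B' = B * Z)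
    (π : Equiv.Perm (Fin K)) (hLπ : ∀ k, L (π k) = L k)
    (hXπ : ∀ p q, X p q ≠ 0 → q.1 = π p.1) (hZπ : ∀ p q, Z p q ≠ 0 → q.1 = π p.1)
    (hXZ : ∀ x : Fin T → ℂ, X * Matrix.diagonal (fun q : Σ k, Fin (L k) => (x ᵥ* C') q.1) * Zᵀ =
      Matrix.diagonal fun q : Σ k, Fin (L k) => (x ᵥ* C) q.1)
    (x₀ : Fin T → ℂ) (hx₀ : ∀ k, (x₀ ᵥ* C) k ≠ 0) (hx₀π : ∀ k, (x₀ ᵥ* C') (π k) ≠ 0) :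
    BTDEquiv A B C A' B' C' := by
  let a : ∀ k, Matrix (Fin (L k)) (Fin (L k)) ℂ := fun k =>
    Matrix.of fun i j => X ⟨k, i⟩ ⟨π k, Fin.cast (hLπ k).symm j⟩
  let b : ∀ k, Matrix (Fin (L k)) (Fin (L k)) ℂ := fun k =>
    Matrix.of fun i j => Z ⟨k, i⟩ ⟨π k, Fin.cast (hLπ k).symm j⟩
  -- the diagonal block of the identity `X * D' x * Zᵀ = D x`
  have hab : ∀ x k, (x ᵥ* C') (π k) • (a k * (b k)ᵀ) = (x ᵥ* C) k • 1 := by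
    intro x k
    ext i i'
    have h1 := congrFun (congrFun (hXZ x) ⟨k, i⟩) ⟨k, i'⟩
    rw [Matrix.mul_apply, Fintype.sum_sigma, Finset.sum_eq_single (π k)] at h1
    · rw [Matrix.smul_apply, Matrix.mul_apply, smul_eq_mul, Finset.mul_sum]
      rw [← (finCongr (hLπ k)).sum_comp]
      refine Eq.trans (Finset.sum_congr rfl fun j _ => ?_) (h1.trans ?_)
      · simp [a, b, Matrix.mul_diagonal]; ring
      · simp [Matrix.diagonal_apply, Matrix.one_apply]
    · intro l _ hl
      refine Finset.sum_eq_zero fun j _ => ?_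
      have : X ⟨k, i⟩ ⟨l, j⟩ = 0 := by
        by_contra hne
        exact hl (hXπ _ _ hne)
      simp [Matrix.mul_diagonal, this]
    · simp
  have hunit : ∀ k, ((x₀ ᵥ* C') (π k) / (x₀ ᵥ* C) k) • (a k * (b k)ᵀ) = 1 := by
    intro k
    rw [div_eq_inv_mul, mul_smul, hab, smul_smul, inv_mul_cancel₀ (hx₀ k), one_smul]
  -- equating the contractions against `x₀` determines the scaling of the third mode
  refine ⟨π, a, b, fun k => (x₀ ᵥ* C') (π k) / (x₀ ᵥ* C) k, hLπ, fun k => ⟨?_, ?_,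
    div_ne_zero (hx₀π k) (hx₀ k), hunit k⟩, ?_, ?_, ?_⟩
  · have h1 := hunit k
    rw [← Matrix.mul_smul] at h1
    exact IsUnit.of_mul_eq_one _ h1
  · have h1 := hunit k
    rw [← Matrix.smul_mul] at h1
    exact (Matrix.isUnit_transpose _).1 (IsUnit.of_mul_eq_one_right _ h1)
  · rw [Matrix.mul_assoc, ← eq_blockDiagonal'_mul_blockPermMatrix π hLπ X hXπ, ← hAX]
  · rw [Matrix.mul_assoc, ← eq_blockDiagonal'_mul_blockPermMatrix π hLπ Z hZπ, ← hBZ]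
  · ext t l
    obtain ⟨k, rfl⟩ := π.surjective l
    have h1 := congrFun (congrFun (hab (Pi.single t 1) k) ⟨0, hL k⟩) ⟨0, hL k⟩
    have h2 := congrFun (congrFun (hunit k) ⟨0, hL k⟩) ⟨0, hL k⟩
    simp only [Matrix.smul_apply, smul_eq_mul, Matrix.one_apply_eq, Matrix.single_one_vecMul,
      Matrix.row_apply, mul_one] at h1 h2
    rw [Equiv.Perm.permMatrix, PEquiv.mul_toMatrix_toPEquiv, Matrix.submatrix_apply,
      π.symm_apply_apply, Matrix.mul_diagonal, id_eq, ← h1]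
    linear_combination -C' t (π k) * h2

theorem exists_ne_zero_of_mul_eq_one {n : Type*} [Fintype n] [DecidableEq n]
    {X W : Matrix n n ℂ} (h : W * X = 1) (q : n) : ∃ p, X p q ≠ 0 := by
  by_contra! h0
  have := congrFun (congrFun h q) q
  simp [Matrix.mul_apply, h0] at this

/-- If the factor matrices of the first two modes have full column rank and the columns of the
third one are pairwise independent, then every decomposition with the same block sizes is
equivalent to the given one. The competing decomposition is compared with the given one through
its contractions along the third mode. -/
theorem IsBTD.btdEquiv {K : ℕ} {L : Fin K → ℕ} {I J T : ℕ} (hL : ∀ k, 1 ≤ L k)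
    {A : Matrix (Fin I) (Σ k, Fin (L k)) ℂ} {B : Matrix (Fin J) (Σ k, Fin (L k)) ℂ}
    {C : Matrix (Fin T) (Fin K) ℂ} {Y : Fin I → Fin J → Fin T → ℂ} (h : IsBTD A B C Y)
    (hA : LinearIndependent ℂ A.col) (hB : LinearIndependent ℂ B.col)
    (hC : ∀ i j, i ≠ j → LinearIndependent ℂ ![C.col i, C.col j])
    {A' : Matrix (Fin I) (Σ k, Fin (L k)) ℂ} {B' : Matrix (Fin J) (Σ k, Fin (L k)) ℂ}
    {C' : Matrix (Fin T) (Fin K) ℂ} (h' : IsBTD A' B' C' Y) : BTDEquiv A B C A' B' C' := by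
  obtain ⟨x₀, x₁, hx₀, hinj⟩ := exists_vecMul_separating C (fun k => (h.1 k).2.2) hC
  let d : (Fin T → ℂ) → (Σ k, Fin (L k)) → ℂ := fun x q => (x ᵥ* C) q.1
  let d' : (Fin T → ℂ) → (Σ k, Fin (L k)) → ℂ := fun x q => (x ᵥ* C') q.1
  obtain ⟨X, Z, hAX, hBZ, hXu, hx₀', hXZ⟩ := exists_baseChange hA hB d d'
    (fun x => (mul_diagonal_mul_transpose_eq h'.2 x).trans
      (mul_diagonal_mul_transpose_eq h.2 x).symm) (x₀ := x₀) fun q => hx₀ q.1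
  have hZX : ∀ x, Z * Matrix.diagonal (d' x) * Xᵀ = Matrix.diagonal (d x) := by
    intro x
    have := congrArg Matrix.transpose (hXZ x)
    rw [Matrix.transpose_mul, Matrix.transpose_mul, Matrix.transpose_transpose,
      Matrix.diagonal_transpose, Matrix.diagonal_transpose, ← Matrix.mul_assoc] at this
    exact this
  have hd : ∀ q, d x₀ q ≠ 0 := fun q => hx₀ q.1
  -- nonzero entries of `X` and `Z` match the ratios of the two decompositions
  obtain ⟨r, hr⟩ : ∃ r : Fin K → ℂ, r = fun k => (x₁ ᵥ* C) k / (x₀ ᵥ* C) k := ⟨_, rfl⟩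
  obtain ⟨r', hr'⟩ : ∃ r' : Fin K → ℂ, r' = fun k => (x₁ ᵥ* C') k / (x₀ ᵥ* C') k := ⟨_, rfl⟩
  rw [← hr] at hinj
  have hX : ∀ p q, X p q ≠ 0 → r p.1 = r' q.1 := fun p q hpq => by
    rw [hr, hr']
    exact ratio_eq_of_mul_diagonal_mul hd (hXZ x₀) (hXZ x₁) hx₀' hpq
  have hZ : ∀ p q, Z p q ≠ 0 → r p.1 = r' q.1 := fun p q hpq => by
    rw [hr, hr']
    exact ratio_eq_of_mul_diagonal_mul hd (hZX x₀) (hZX x₁) hx₀' hpq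
  -- every block column of `X` is nonzero, and so is every block row
  have hcol : ∀ l, ∃ k, r k = r' l := fun l => by
    obtain ⟨p, hp⟩ := exists_ne_zero_of_mul_eq_one (Matrix.nonsing_inv_mul X hXu)
      ⟨l, ⟨0, hL l⟩⟩
    exact ⟨p.1, hX _ _ hp⟩
  choose σ hσ using hcol
  have hXσ : ∀ p q, X p q ≠ 0 → p.1 = σ q.1 := fun p q hpq =>
    hinj ((hX p q hpq).trans (hσ q.1).symm)
  have hZσ : ∀ p q, Z p q ≠ 0 → p.1 = σ q.1 := fun p q hpq =>
    hinj ((hZ p q hpq).trans (hσ q.1).symm)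
  have hσs : Function.Surjective σ := fun k => by
    have h1 : X⁻¹ᵀ * Xᵀ = 1 := by
      rw [← Matrix.transpose_mul, Matrix.mul_nonsing_inv X hXu, Matrix.transpose_one]
    obtain ⟨q, hq⟩ := exists_ne_zero_of_mul_eq_one h1 ⟨k, ⟨0, hL k⟩⟩
    exact ⟨q.1, (hXσ _ _ hq).symm⟩
  obtain ⟨ρ, hρ⟩ : ∃ ρ : Equiv.Perm (Fin K), ∀ l, ρ l = σ l :=
    ⟨Equiv.ofBijective σ (Finite.surjective_iff_bijective.1 hσs), fun _ => rfl⟩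
  have hπ : ∀ p q : Σ k, Fin (L k), p.1 = σ q.1 → q.1 = ρ.symm p.1 := fun p q hpq => by
    rw [hpq, ← hρ, ρ.symm_apply_apply]
  have hLπ : ∀ k, L (ρ.symm k) = L k := fun k => by
    have := card_eq_of_support ρ (Matrix.nonsing_inv_mul X hXu)
      (fun p q hpq => (hXσ p q hpq).trans (hρ _).symm) (ρ.symm k)
    rw [ρ.apply_symm_apply] at this
    exact this.symm
  exact btdEquiv_of_support hL hAX hBZ ρ.symm hLπ
    (fun p q hpq => hπ _ _ (hXσ p q hpq))
    (fun p q hpq => hπ _ _ (hZσ p q hpq)) hXZ x₀ hx₀ fun k => hx₀' ⟨ρ.symm k, ⟨0, hL _⟩⟩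

theorem isEssentiallyUniqueBTD_of_linearIndependent {K : ℕ} {L : Fin K → ℕ} {I J T : ℕ}
    (hL : ∀ k, 1 ≤ L k)
    {A : Matrix (Fin I) (Σ k, Fin (L k)) ℂ} {B : Matrix (Fin J) (Σ k, Fin (L k)) ℂ}
    {C : Matrix (Fin T) (Fin K) ℂ} {Y : Fin I → Fin J → Fin T → ℂ}
    (hA : LinearIndependent ℂ A.col) (hB : LinearIndependent ℂ B.col)
    (hC0 : ∀ k, C.col k ≠ 0)
    (hC : ∀ i j, i ≠ j → LinearIndependent ℂ ![C.col i, C.col j])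
    (hY : ∀ i j t, Y i j t = ∑ k, (block A k * (block B k)ᵀ) i j * C t k) :
    IsEssentiallyUniqueBTD A B C Y :=
  have h : IsBTD A B C Y := ⟨fun k => ⟨rank_block_eq hA k, rank_block_eq hB k, hC0 k⟩, hY⟩
  ⟨h, fun _ _ _ h' => h.btdEquiv hL hA hB hC h'⟩

/-! ### Non-uniqueness of the canonical polyadic decomposition -/

theorem mul_diagonal_mul_permMatrix_apply {m Q : Type*} [Fintype Q] [DecidableEq Q]
    (A : Matrix m Q ℂ) (a : Q → ℂ) (π : Equiv.Perm Q) (i : m) (q : Q) :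
    (A * Matrix.diagonal a * π.permMatrix ℂ) i q = A i (π.symm q) * a (π.symm q) := by
  rw [Equiv.Perm.permMatrix, PEquiv.mul_toMatrix_toPEquiv, Matrix.submatrix_apply,
    Matrix.mul_diagonal, id_eq]

section

variable {Q : Type*} [Fintype Q] [DecidableEq Q] {I J T : ℕ}
  {A A' : Matrix (Fin I) Q ℂ} {B B' : Matrix (Fin J) Q ℂ} {C C' : Matrix (Fin T) Q ℂ}
  {Y : Fin I → Fin J → Fin T → ℂ}

/-- Equivalent decompositions have the same rank-one terms up to order. -/
theorem CPDEquiv.exists_term_eq (h : CPDEquiv A B C A' B' C') (q : Q) :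
    ∃ q', ∀ i j t, A' i q * B' j q * C' t q = A i q' * B j q' * C t q' := by
  obtain ⟨π, a, b, c, habc, rfl, rfl, rfl⟩ := h
  refine ⟨π.symm q, fun i j t => ?_⟩
  have h1 := congrFun (congrFun habc (π.symm q)) (π.symm q)
  rw [Matrix.diagonal_mul_diagonal, Matrix.diagonal_mul_diagonal, Matrix.diagonal_apply_eq,
    Matrix.one_apply_eq] at h1
  simp only [mul_diagonal_mul_permMatrix_apply]
  linear_combination A i (π.symm q) * B j (π.symm q) * C t (π.symm q) * h1

/-- A vanishing column in the second mode is incompatible with equivalence to a decomposition into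
nonzero rank-one terms. -/
theorem CPDEquiv.col_ne_zero (h : CPDEquiv A B C A' B' C') (h' : IsCPD A' B' C' Y) (q : Q) :
    B.col q ≠ 0 := by
  obtain ⟨π, a, b, c, -, rfl, rfl, rfl⟩ := h
  intro h0
  apply (h'.1 (π q)).2.1
  funext j
  rw [mul_diagonal_mul_permMatrix_apply, π.symm_apply_apply, show B j q = 0 from congrFun h0 j,
    zero_mul, Pi.zero_apply]

/-- If two terms share the third factor `s`, then the terms `u ∘ v ∘ s + u' ∘ v' ∘ s` can be
replaced by `u ∘ (v + c v') ∘ s + (u' - c u) ∘ v' ∘ s`; for generic `c` this gives a new term. -/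
theorem not_cpdUnique_of_col_ne_zero (hA : ∀ q, A.col q ≠ 0) (hB : ∀ q, B.col q ≠ 0)
    (hC : ∀ q, C.col q ≠ 0) (hY : ∀ i j t, Y i j t = ∑ q, A i q * B j q * C t q)
    {x y : Q} (hxy : x ≠ y) (hCxy : C.col x = C.col y) : ¬ CPDUnique A B C Y := by
  classical
  obtain ⟨i, hi⟩ := Function.ne_iff.1 (hA x)
  obtain ⟨j, hj⟩ := Function.ne_iff.1 (hB y)
  obtain ⟨t, ht⟩ := Function.ne_iff.1 (hC x)
  simp only [Matrix.col, Matrix.transpose_apply, Pi.zero_apply] at hi hj ht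
  -- every excluded value of `c` solves an affine equation at a fixed entry `(i, j, t)`
  obtain ⟨c, hc⟩ := Infinite.exists_notMem_finset
    (insert (-(B j x / B j y)) (insert (A i y / A i x)
      (Finset.univ.image fun q => (A i q * B j q * C t q / (A i x * C t x) - B j x) / B j y)))
  simp only [Finset.mem_insert, Finset.mem_image, Finset.mem_univ, true_and, not_or,
    not_exists] at hc
  obtain ⟨hc1, hc2, hc3⟩ := hc
  intro hu
  have hcpd : IsCPD (A.updateCol y (A.col y - c • A.col x)) (B.updateCol x (B.col x + c • B.col y))
      C Y := by
    refine ⟨fun q => ⟨?_, ?_, hC q⟩, fun i' j' t' => ?_⟩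
    · by_cases hq : q = y
      · subst hq
        refine Function.ne_iff.2 ⟨i, fun h => hc2 ?_⟩
        simp [Matrix.col] at h
        field_simp
        linear_combination -h
      · simp only [Matrix.updateCol_apply, hq, if_false]
        exact hA q
    · by_cases hq : q = x
      · subst hq
        refine Function.ne_iff.2 ⟨j, fun h => hc1 ?_⟩
        simp [Matrix.col] at h
        field_simp
        linear_combination h
      · simp only [Matrix.updateCol_apply, hq, if_false]
        exact hB q
    · rw [hY, ← sub_eq_zero, ← Finset.sum_sub_distrib, Finset.sum_eq_add x y hxy]
      · have : C t' x = C t' y := congrFun hCxy t'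
        simp [Matrix.col, hxy, hxy.symm, this]
        ring
      · rintro q - ⟨hqx, hqy⟩
        simp [hqx, hqy]
      · simp
      · simp
  obtain ⟨q, hq⟩ := (hu _ _ _ hcpd).exists_term_eq x
  apply hc3 q
  rw [← hq i j t]
  simp [Matrix.col, hxy]
  field_simp
  ring

/-- A sum of at least two rank-one terms, some of which vanish because of their second factor, is
also a sum of the same number of nonzero terms: a nonzero term is split into equal parts, or, if
there is none, multiples of a fixed rank-one tensor with vanishing sum are used. -/
theorem exists_isCPD (hA : ∀ q, A.col q ≠ 0) (hC : ∀ q, C.col q ≠ 0) (hJ : 1 ≤ J)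
    (hY : ∀ i j t, Y i j t = ∑ q, A i q * B j q * C t q) {x y : Q} (hxy : x ≠ y) :
    ∃ A' B' C', IsCPD (Q := Q) (I := I) (J := J) (T := T) A' B' C' Y := by
  classical
  by_cases hB : ∃ q, B.col q ≠ 0
  · obtain ⟨q₁, hq₁⟩ := hB
    let W : Finset Q := insert q₁ (Finset.univ.filter fun q => B.col q = 0)
    have hW : (W.card : ℂ) ≠ 0 := by
      exact_mod_cast (Finset.card_pos.2 ⟨q₁, Finset.mem_insert_self _ _⟩).ne'
    refine ⟨Matrix.of fun i q => if q ∈ W then A i q₁ else A i q,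
      Matrix.of fun j q => if q ∈ W then B j q₁ else B j q,
      Matrix.of fun t q => if q ∈ W then (W.card : ℂ)⁻¹ * C t q₁ else C t q,
      fun q => ?_, fun i j t => ?_⟩
    · by_cases hq : q ∈ W
      · simp only [Matrix.of_apply, hq, if_true]
        refine ⟨hA q₁, hq₁, ?_⟩
        exact smul_ne_zero (inv_ne_zero hW) (hC q₁)
      · simp only [Matrix.of_apply, hq, if_false]
        refine ⟨hA q, fun h0 => hq ?_, hC q⟩
        exact Finset.mem_insert_of_mem (Finset.mem_filter.2 ⟨Finset.mem_univ _, h0⟩)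
    · rw [hY, ← Finset.sum_add_sum_compl W, ← Finset.sum_add_sum_compl W]
      congr 1
      · trans A i q₁ * B j q₁ * C t q₁
        · refine Finset.sum_eq_single_of_mem q₁ (Finset.mem_insert_self _ _) fun q hq hne => ?_
          have : B.col q = 0 := (Finset.mem_filter.1 ((Finset.mem_insert.1 hq).resolve_left hne)).2
          rw [show B j q = 0 from congrFun this j, mul_zero, zero_mul]
        · rw [Finset.sum_congr rfl (g := fun _ => A i q₁ * B j q₁ * ((W.card : ℂ)⁻¹ * C t q₁))]
          · rw [Finset.sum_const, nsmul_eq_mul]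
            field_simp
          · intro q hq
            simp [hq]
      · refine Finset.sum_congr rfl fun q hq => ?_
        simp [Finset.mem_compl.1 hq]
  · push Not at hB
    have hcard : (2 : ℕ) ≤ Fintype.card Q := by
      have := Finset.card_le_univ ({x, y} : Finset Q)
      rwa [Finset.card_pair hxy] at this
    refine ⟨Matrix.of fun i _ => A i x, Matrix.of fun _ _ => 1,
      Matrix.of fun t q => (1 - if q = x then (Fintype.card Q : ℂ) else 0) * C t x,
      fun q => ⟨hA x, fun h => one_ne_zero (congrFun h ⟨0, hJ⟩), ?_⟩, fun i j t => ?_⟩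
    · have hc : (1 - if q = x then (Fintype.card Q : ℂ) else 0) ≠ 0 := by
        split_ifs
        · rw [sub_ne_zero]
          exact_mod_cast (by omega : 1 ≠ Fintype.card Q)
        · simp
      exact smul_ne_zero hc (hC x)
    · rw [hY, Finset.sum_eq_zero fun q _ => by
        rw [show B j q = 0 from congrFun (hB q) j, mul_zero, zero_mul]]
      simp [← Finset.mul_sum, ← Finset.sum_mul]

theorem not_cpdUnique (hA : ∀ q, A.col q ≠ 0) (hC : ∀ q, C.col q ≠ 0) (hJ : 1 ≤ J)
    (hY : ∀ i j t, Y i j t = ∑ q, A i q * B j q * C t q)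
    {x y : Q} (hxy : x ≠ y) (hCxy : C.col x = C.col y) : ¬ CPDUnique A B C Y := by
  by_cases hB : ∀ q, B.col q ≠ 0
  · exact not_cpdUnique_of_col_ne_zero hA hB hC hY hxy hCxy
  · intro hu
    obtain ⟨A', B', C', h'⟩ := exists_isCPD hA hC hJ hY hxy
    exact hB fun q => (hu _ _ _ h').col_ne_zero h' q

end

/-! ### Zeros of polynomials in independent random variables -/

/-- The zero set of a nonzero polynomial is null for a product of atomless measures. -/
theorem ae_eval_ne_zero {n : ℕ} (ν : Fin n → Measure ℂ) [∀ i, SigmaFinite (ν i)]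
    [∀ i, NullSingletonClass (ν i)] {p : MvPolynomial (Fin n) ℂ} (hp : p ≠ 0) :
    ∀ᵐ z ∂Measure.pi ν, MvPolynomial.eval z p ≠ 0 := by
  induction n with
  | zero =>
    obtain ⟨c, rfl⟩ := MvPolynomial.C_surjective (Fin 0) p
    refine Filter.Eventually.of_forall fun z => ?_
    simpa using hp
  | succ n ih =>
    have hp' : MvPolynomial.finSuccEquiv ℂ n p ≠ 0 := by simpa using hp
    -- off the zeros of the leading coefficient, the first variable only has to avoid finitely many roots
    have hlead := ih (fun j => ν (Fin.succ j)) (Polynomial.leadingCoeff_ne_zero.2 hp')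
    have hmp := measurePreserving_piFinSuccAbove ν 0
    have hswap : ∀ᵐ z ∂(ν 0).prod (Measure.pi fun j => ν (Fin.succAbove 0 j)),
        MvPolynomial.eval (Fin.cons z.1 z.2 : Fin (n + 1) → ℂ) p ≠ 0 := by
      have hmeas : Measurable fun z : ℂ × (Fin n → ℂ) =>
          MvPolynomial.eval (Fin.cons z.1 z.2 : Fin (n + 1) → ℂ) p := by
        refine (MvPolynomial.continuous_eval p).measurable.comp ?_
        refine measurable_pi_iff.2 fun i => ?_
        refine Fin.cases ?_ (fun j => ?_) i
        · simpa using measurable_fst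
        · simpa [Function.comp_def] using
            (measurable_pi_apply j).comp (measurable_snd (α := ℂ) (β := Fin n → ℂ))
      have hprod : ∀ᵐ z ∂(Measure.pi fun j => ν (Fin.succAbove 0 j)).prod (ν 0),
          MvPolynomial.eval (Fin.cons z.2 z.1 : Fin (n + 1) → ℂ) p ≠ 0 := by
        rw [Measure.ae_prod_iff_ae_ae]
        · simp only [Fin.zero_succAbove]
          filter_upwards [hlead] with s hs
          have hne : Polynomial.map (MvPolynomial.eval s) (MvPolynomial.finSuccEquiv ℂ n p) ≠ 0 := by
            intro h0
            apply hs
            have := congrArg (fun q => Polynomial.coeff q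
              (MvPolynomial.finSuccEquiv ℂ n p).natDegree) h0
            simpa using this
          rw [ae_iff]
          refine measure_mono_null (fun y hy => ?_)
            ((Polynomial.finite_setOfPred_isRoot hne).measure_zero (ν 0))
          simpa [MvPolynomial.eval_eq_eval_mv_eval'] using hy
        · exact (hmeas.comp measurable_swap) (measurableSet_singleton 0).compl
      exact (Measure.measurePreserving_swap.quasiMeasurePreserving.ae hprod)
    have := hmp.quasiMeasurePreserving.ae hswap
    filter_upwards [this] with z hz
    convert hz using 3
    funext i
    refine Fin.cases ?_ (fun j => ?_) i <;> simp [MeasurableEquiv.piFinSuccAbove, Fin.tail]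

/-- A nonzero polynomial does not vanish almost surely at independent random variables with
atomless laws. -/
theorem ae_eval_ne_zero_of_iIndepFun {Ω ι : Type*} [MeasurableSpace Ω] {μ : Measure Ω}
    [IsProbabilityMeasure μ] [Fintype ι] {X : ι → Ω → ℂ} (hXm : ∀ i, Measurable (X i))
    (hX : iIndepFun X μ) (hX0 : ∀ i, NullSingletonClass (μ.map (X i))) {p : MvPolynomial ι ℂ} (hp : p ≠ 0) :
    ∀ᵐ ω ∂μ, MvPolynomial.eval (fun i => X i ω) p ≠ 0 := by
  let e := Fintype.equivFin ι
  have hX' : iIndepFun (fun j => X (e.symm j)) μ := hX.precomp e.symm.injective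
  have hlaw := hX'.map_fun_eq_pi_map fun j => (hXm _).aemeasurable
  have : ∀ j, IsProbabilityMeasure (μ.map (X (e.symm j))) := fun j =>
    Measure.isProbabilityMeasure_map (hXm _).aemeasurable
  have hp' : MvPolynomial.rename e p ≠ 0 := by
    simpa using (MvPolynomial.rename_injective e e.injective).ne hp
  have h := ae_eval_ne_zero (fun j => μ.map (X (e.symm j))) hp'
  rw [← hlaw] at h
  have h2 := ae_of_ae_map (measurable_pi_iff.2 fun j => hXm (e.symm j)).aemeasurable h
  filter_upwards [h2] with ω hω
  rw [MvPolynomial.eval_rename] at hω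
  have hfun : (fun j => X (e.symm j) ω) ∘ e = fun i => X i ω := by
    funext i
    simp
  rwa [hfun] at hω

/-- If `W` is an `M × N` matrix of independent random variables with atomless laws and `B` has
full column rank with at most `M` columns, then `W * B` almost surely has full column rank: for a
choice of as many rows as `B` has columns, the determinant of the corresponding minor of `W * B` is
a polynomial in the entries of `W`, and it is nonzero at a left inverse of `B`. -/
theorem ae_linearIndependent_col_mul {Ω : Type*} [MeasurableSpace Ω] {μ : Measure Ω}
    [IsProbabilityMeasure μ] {M N : ℕ} {n : Type*} [Fintype n] [DecidableEq n]
    {X : Fin M × Fin N → Ω → ℂ} (hXm : ∀ i, Measurable (X i))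
    (hX : iIndepFun X μ) (hX0 : ∀ i, NullSingletonClass (μ.map (X i))) {B : Matrix (Fin N) n ℂ}
    (hB : LinearIndependent ℂ B.col) (hM : Fintype.card n ≤ M) :
    ∀ᵐ ω ∂μ, LinearIndependent ℂ
      ((Matrix.of fun m k => X (m, k) ω : Matrix (Fin M) (Fin N) ℂ) * B).col := by
  obtain ⟨f⟩ : Nonempty (n ↪ Fin M) :=
    Function.Embedding.nonempty_of_card_le (by simpa using hM)
  obtain ⟨W, hW⟩ := exists_mul_eq_one_of_linearIndependent_col hB
  let V : Matrix n (Fin N) (MvPolynomial (Fin M × Fin N) ℂ) :=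
    Matrix.of fun i k => MvPolynomial.X (f i, k)
  let B' : Matrix (Fin N) n (MvPolynomial (Fin M × Fin N) ℂ) := B.map MvPolynomial.C
  let p : MvPolynomial (Fin M × Fin N) ℂ := (V * B').det
  have heval : ∀ z : Fin M × Fin N → ℂ, MvPolynomial.eval z p =
      Matrix.det ((Matrix.of fun i k => z (f i, k) : Matrix n (Fin N) ℂ) * B) := by
    intro z
    rw [RingHom.map_det, RingHom.mapMatrix_apply, Matrix.map_mul]
    congr 2
    · ext i k; simp [V]
    · ext i k; simp [B']
  have hp : p ≠ 0 := by
    intro h0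
    have h1 := heval fun x => if h : ∃ i, f i = x.1 then W h.choose x.2 else 0
    have h2 : (Matrix.of fun (i : n) (k : Fin N) =>
        if h : ∃ i', f i' = f i then W h.choose k else 0) = W := by
      ext i k
      have h : ∃ i', f i' = f i := ⟨i, rfl⟩
      rw [Matrix.of_apply, dif_pos h, f.injective h.choose_spec]
    simp only [h2, hW, h0, map_zero, Matrix.det_one] at h1
    exact zero_ne_one h1
  filter_upwards [ae_eval_ne_zero_of_iIndepFun hXm hX hX0 hp] with ω hω
  rw [heval] at hω
  have hli := Matrix.linearIndependent_cols_of_det_ne_zero hω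
  refine LinearIndependent.of_comp (LinearMap.funLeft ℂ ℂ f) ?_
  exact hli

/-! ### The factor matrices of the near-field model -/

theorem linearIndependent_pow {n : Type*} [Fintype n] {P : ℕ} (hP : Fintype.card n ≤ P)
    {v : n → ℂ} (hv : Function.Injective v) :
    LinearIndependent ℂ fun (l : n) (p : Fin P) => v l ^ (p : ℕ) := by
  let e := Fintype.equivFin n
  have hdet := Matrix.det_vandermonde_ne_zero_iff.2 (hv.comp e.symm.injective)
  have hli := (Matrix.linearIndependent_rows_of_det_ne_zero hdet).comp e e.injective
  refine LinearIndependent.of_comp (LinearMap.funLeft ℂ ℂ (Fin.castLE hP)) ?_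
  have hfun : (LinearMap.funLeft ℂ ℂ (Fin.castLE hP) ∘ fun (l : n) (p : Fin P) => v l ^ (p : ℕ)) =
      (fun i => Matrix.vandermonde (v ∘ e.symm) i) ∘ e := by
    funext l p
    simp [LinearMap.funLeft]
  rw [hfun]
  exact hli

section Model

variable {K : ℕ} {L : Fin K → ℕ}

theorem received_eq_sum_block (sys : System) {N M T : ℕ} (P : ℕ) (path : ∀ k, Fin (L k) → Path)
    (w : Fin M → Fin N → ℂ) (s : Fin K → Fin T → ℂ) (p : Fin P) (m : Fin M) (t : Fin T) :
    received sys P path w s p m t = ∑ k, (block (delayMatrix sys P path) k *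
      (block (spatialMatrix sys path w) k)ᵀ) p m * pilotMatrix s t k := by
  simp only [received, dotProduct_sum, dotProduct_smul, System.channel, smul_eq_mul]
  refine Finset.sum_congr rfl fun k _ => ?_
  rw [Matrix.mul_apply, mul_comm]
  congr 1
  refine Finset.sum_congr rfl fun i _ => ?_
  simp only [block, delayMatrix, spatialMatrix, Matrix.of_apply, Matrix.transpose_apply]
  ring

theorem pathPilotMatrix_apply (L : Fin K → ℕ) {T : ℕ} (s : Fin K → Fin T → ℂ) (t : Fin T)
    (l : Σ k, Fin (L k)) : pathPilotMatrix L s t l = s l.1 t := by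
  simp [pathPilotMatrix, pilotMatrix, userMatrix, Matrix.mul_apply]

theorem received_eq_sum_path (sys : System) {N M T : ℕ} (P : ℕ) (path : ∀ k, Fin (L k) → Path)
    (w : Fin M → Fin N → ℂ) (s : Fin K → Fin T → ℂ) (p : Fin P) (m : Fin M) (t : Fin T) :
    received sys P path w s p m t = ∑ l, delayMatrix sys P path p l *
      spatialMatrix sys path w m l * pathPilotMatrix L s t l := by
  rw [received_eq_sum_block, Fintype.sum_sigma]
  refine Finset.sum_congr rfl fun k _ => ?_
  rw [Matrix.mul_apply, Finset.sum_mul]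
  simp [pathPilotMatrix_apply, pilotMatrix, block]

/-- Up to column scaling, the delay matrix is a Vandermonde matrix, whose nodes are distinct when
the delays are distinct modulo `P / B`. -/
theorem linearIndependent_col_delayMatrix (sys : System) {P : ℕ} (path : ∀ k, Fin (L k) → Path)
    (hP : ∑ k, L k ≤ P)
    (hτ : ∀ l l' : Σ k, Fin (L k), l ≠ l' → ∀ z : ℤ,
      (path l.1 l.2).delay - (path l'.1 l'.2).delay ≠ z * (P / sys.bandwidth)) :
    LinearIndependent ℂ (delayMatrix sys P path).col := by
  rcases Nat.eq_zero_or_pos P with rfl | hP0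
  · have : IsEmpty (Σ k, Fin (L k)) := by
      rw [← Fintype.card_eq_zero_iff]
      simpa using hP
    exact linearIndependent_empty_type
  have hPne : (P : ℝ) ≠ 0 := by exact_mod_cast hP0.ne'
  have hPc : (P : ℂ) ≠ 0 := by exact_mod_cast hP0.ne'
  have hB := sys.bandwidth_pos.ne'
  let v : (Σ k, Fin (L k)) → ℂ := fun l =>
    Complex.exp (-Complex.I * ((2 * Real.pi * (sys.bandwidth / P) * (path l.1 l.2).delay : ℝ) : ℂ))
  let c : (Σ k, Fin (L k)) → ℂ := fun l =>
    Complex.exp (-Complex.I * ((2 * Real.pi * (sys.carrier + (2 - P) / (2 * P) * sys.bandwidth) *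
      (path l.1 l.2).delay : ℝ) : ℂ))
  have hv : Function.Injective v := by
    intro l l' h
    by_contra hne
    obtain ⟨n, hn⟩ := Complex.exp_eq_exp_iff_exists_int.1 h
    refine hτ l l' hne (-n) ?_
    have h1 : ((2 * Real.pi * (sys.bandwidth / P) * (path l.1 l.2).delay : ℝ) : ℂ) =
        ((2 * Real.pi * (sys.bandwidth / P) * (path l'.1 l'.2).delay - n * (2 * Real.pi) : ℝ) :
          ℂ) := by
      refine mul_left_cancel₀ (neg_ne_zero.2 Complex.I_ne_zero) ?_
      rw [hn]
      push_cast
      ring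
    have h2 := Complex.ofReal_injective h1
    have h3 : sys.bandwidth * ((path l.1 l.2).delay - (path l'.1 l'.2).delay) = -n * P := by
      have hπ := Real.pi_ne_zero
      field_simp at h2
      linear_combination h2
    push_cast
    field_simp
    linear_combination h3
  have hcard : Fintype.card (Σ k, Fin (L k)) ≤ P := by simpa using hP
  have hli := (linearIndependent_pow hcard hv).units_smul
    fun l => Units.mk0 (c l) (Complex.exp_ne_zero _)
  convert hli using 1
  funext l p
  simp only [delayMatrix, System.delayResponse, System.freq, Matrix.col, Matrix.transpose_apply,
    Matrix.of_apply, Pi.smul_apply', Pi.smul_apply, Units.smul_def, Units.val_mk0, smul_eq_mul, v, c]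
  rw [← Complex.exp_nat_mul, ← Complex.exp_add]
  congr 1
  push_cast
  field_simp
  ring

theorem spatialMatrix_eq_mul (sys : System) {N M : ℕ} (path : ∀ k, Fin (L k) → Path)
    (w : Fin M → Fin N → ℂ) :
    spatialMatrix sys path w = (Matrix.of fun m n => star (w m n) : Matrix (Fin M) (Fin N) ℂ) *
      (Matrix.of fun n l => (path l.1 l.2).gain *
        sys.steering N (path l.1 l.2).angle (path l.1 l.2).dist n :
          Matrix (Fin N) (Σ k, Fin (L k)) ℂ) := by
  ext m l
  simp only [spatialMatrix, Matrix.of_apply, Matrix.mul_apply, dotProduct, Finset.mul_sum,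
    Pi.star_apply]
  exact Finset.sum_congr rfl fun n _ => by ring

theorem countable_setOf_star_exp_eq (z : ℂ) :
    {x : ℝ | star (Complex.exp (Complex.I * (x : ℂ))) = z}.Countable := by
  by_cases h : ∃ x₀ : ℝ, star (Complex.exp (Complex.I * (x₀ : ℂ))) = z
  · obtain ⟨x₀, rfl⟩ := h
    refine (Set.countable_range fun n : ℤ => x₀ + n * (2 * Real.pi)).mono fun x hx => ?_
    obtain ⟨n, hn⟩ := Complex.exp_eq_exp_iff_exists_int.1 (star_injective hx)
    refine ⟨n, Complex.ofReal_injective (mul_left_cancel₀ Complex.I_ne_zero ?_)⟩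
    rw [hn]
    push_cast
    ring
  · refine Set.Countable.mono (fun x hx => (h ⟨x, hx⟩).elim) Set.countable_empty

theorem measurable_star_exp : Measurable fun x : ℝ => star (Complex.exp (Complex.I * (x : ℂ))) := by
  have : Continuous fun x : ℝ => star (Complex.exp (Complex.I * (x : ℂ))) := by fun_prop
  exact this.measurable

/-- For independent uniform phases, the spatial matrix almost surely inherits full
column rank from the steering vectors. -/
theorem ae_linearIndependent_col_spatialMatrix {Ω : Type*} [MeasurableSpace Ω] {μ : Measure Ω}
    [IsProbabilityMeasure μ] {N M : ℕ} (sys : System) (path : ∀ k, Fin (L k) → Path)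
    {Φ : Fin M → Fin N → Ω → ℝ} (hΦm : ∀ m n, Measurable (Φ m n))
    (hΦu : ∀ m n, pdf.IsUniform (Φ m n) (Set.Ioo 0 (2 * Real.pi)) μ volume)
    (hΦi : iIndepFun (fun x : Fin M × Fin N => Φ x.1 x.2) μ) (hM : ∑ k, L k ≤ M)
    (hgain : ∀ k i, (path k i).gain ≠ 0)
    (hst : LinearIndependent ℂ (fun l : Σ k, Fin (L k) =>
        sys.steering N (path l.1 l.2).angle (path l.1 l.2).dist)) :
    ∀ᵐ ω ∂μ, LinearIndependent ℂ
      (spatialMatrix sys path (combiner fun m n => Φ m n ω)).col := by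
  obtain ⟨B, hBdef⟩ : ∃ B : Matrix (Fin N) (Σ k, Fin (L k)) ℂ, B = Matrix.of fun n l =>
    (path l.1 l.2).gain * sys.steering N (path l.1 l.2).angle (path l.1 l.2).dist n := ⟨_, rfl⟩
  have hB : LinearIndependent ℂ B.col := by
    rw [hBdef]
    exact hst.units_smul fun l => Units.mk0 (path l.1 l.2).gain (hgain _ _)
  obtain ⟨f, hf⟩ : ∃ f : ℝ → ℂ, f = fun x : ℝ => star (Complex.exp (Complex.I * (x : ℂ))) :=
    ⟨_, rfl⟩
  have hfm : Measurable f := hf ▸ measurable_star_exp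
  have hX : iIndepFun (fun x : Fin M × Fin N => f ∘ Φ x.1 x.2) μ :=
    hΦi.comp (fun _ => f) fun _ => hfm
  have hX0 : ∀ x : Fin M × Fin N, NullSingletonClass (μ.map (f ∘ Φ x.1 x.2)) := by
    refine fun x => ⟨fun z => ?_⟩
    rw [← Measure.map_map hfm (hΦm x.1 x.2), Measure.map_apply hfm (measurableSet_singleton z)]
    refine (hΦu x.1 x.2).absolutelyContinuous ?_
    rw [hf]
    exact (countable_setOf_star_exp_eq z).measure_zero volume
  have h := ae_linearIndependent_col_mul (fun x => hfm.comp (hΦm x.1 x.2)) hX hX0 hB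
    (by simpa using hM)
  filter_upwards [h] with ω hω
  rw [spatialMatrix_eq_mul, ← hBdef]
  rw [hf] at hω
  exact hω

end Model

end NearField

open NearField in
theorem mainTheorem2
    {Ω : Type*} [MeasurableSpace Ω] (μ : Measure Ω) [IsProbabilityMeasure μ]
    (N P M T K : ℕ) (L : Fin K → ℕ) (hL : ∀ k, 1 ≤ L k)
    (sys : System) (path : ∀ k, Fin (L k) → Path)
    -- the pilots
    (s : Fin K → Fin T → ℂ) (hs : ∀ k, s k ≠ 0)
    -- the phases of the combiner are independent and uniform on (0, 2π)
    (Φ : Fin M → Fin N → Ω → ℝ) (hΦm : ∀ m n, Measurable (Φ m n))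
    (hΦu : ∀ m n, pdf.IsUniform (Φ m n) (Set.Ioo 0 (2 * Real.pi)) μ volume)
    (hΦi : iIndepFun (fun x : Fin M × Fin N => Φ x.1 x.2) μ) :
    let w : Ω → Fin M → Fin N → ℂ := fun ω => combiner fun m n => Φ m n ω
    let Y : Ω → Fin P → Fin M → Fin T → ℂ := fun ω => received sys P path (w ω) s
    let G : Matrix (Fin P) (Σ k, Fin (L k)) ℂ := delayMatrix sys P path
    let A : Ω → Matrix (Fin M) (Σ k, Fin (L k)) ℂ := fun ω => spatialMatrix sys path (w ω)
    let So : Matrix (Fin T) (Fin K) ℂ := pilotMatrix s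
    let S : Matrix (Fin T) (Σ k, Fin (L k)) ℂ := pathPilotMatrix L s
    -- the received tensor is the sum of the rank-one terms of the paths,
    -- and it is the sum of the block terms of the users
    (∀ ω p m t, Y ω p m t = ∑ l, G p l * A ω m l * S t l) ∧
    (∀ ω p m t, Y ω p m t = ∑ k, (block G k * (block (A ω) k)ᵀ) p m * So t k) ∧
    -- the CPD model fails as soon as some user has several paths
    ((∃ k, 2 ≤ L k) →
      (∀ k i j, (fun t => S t ⟨k, i⟩) = fun t => S t ⟨k, j⟩) ∧
      kRank S = 1 ∧
      (∀ ω, kRank G + kRank (A ω) + kRank S < 2 * (∑ k, L k) + 2) ∧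
      (1 ≤ P → 1 ≤ M → ∀ ω, ¬ CPDUnique G (A ω) S (Y ω))) ∧
    -- uniqueness of the BTD when both generalized k-ranks equal `K`
    (2 ≤ T → (∀ i j, i ≠ j → LinearIndependent ℂ ![s i, s j]) →
      (2 ≤ K → 2 ≤ kRank So) ∧
      (∑ k, L k ^ 2 ≤ P * M →
        (∀ ω, blockKRank G = K → blockKRank (A ω) = K →
          (2 ≤ K → 2 * K + 2 ≤ blockKRank G + blockKRank (A ω) + kRank So) ∧
          IsEssentiallyUniqueBTD G (A ω) So (Y ω)) ∧
        ((∀ᵐ ω ∂μ, blockKRank G = K ∧ blockKRank (A ω) = K) →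
          ∀ᵐ ω ∂μ, IsEssentiallyUniqueBTD G (A ω) So (Y ω)))) ∧
    -- the generalized k-ranks equal `K` with probability one
    (∑ k, L k ≤ P → ∑ k, L k ≤ M →
      -- the delays are distinct modulo the unambiguous range `P / B`
      (∀ l l' : Σ k, Fin (L k), l ≠ l' → ∀ z : ℤ,
        (path l.1 l.2).delay - (path l'.1 l'.2).delay ≠ z * (P / sys.bandwidth)) →
      (∀ k i, (path k i).gain ≠ 0) →
      -- the matrix of the steering vectors of all paths has full column rank
      LinearIndependent ℂ (fun l : Σ k, Fin (L k) =>
        sys.steering N (path l.1 l.2).angle (path l.1 l.2).dist) →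
      ∑ k, L k ^ 2 ≤ P * M ∧ blockKRank G = K ∧ (∀ᵐ ω ∂μ, blockKRank (A ω) = K) ∧
      (2 ≤ T → (∀ i j, i ≠ j → LinearIndependent ℂ ![s i, s j]) →
        ∀ᵐ ω ∂μ, IsEssentiallyUniqueBTD G (A ω) So (Y ω))) := by
  intro w Y G A So S
  have hSo : ∀ k, So.col k = s k := fun k => rfl
  have hScol : ∀ l : Σ k, Fin (L k), S.col l = s l.1 := fun l =>
    funext fun t => pathPilotMatrix_apply L s t l
  have hS0 : ∀ l, S.col l ≠ 0 := fun l => by rw [hScol]; exact hs _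
  have hcard : Fintype.card (Σ k, Fin (L k)) = ∑ k, L k := by simp
  have hpath : ∀ ω p m t, Y ω p m t = ∑ l, G p l * A ω m l * S t l := fun ω p m t =>
    received_eq_sum_path sys P path (w ω) s p m t
  have hblock : ∀ ω p m t, Y ω p m t = ∑ k, (block G k * (block (A ω) k)ᵀ) p m * So t k :=
    fun ω p m t => received_eq_sum_block sys P path (w ω) s p m t
  -- full generalized k-ranks mean full column ranks
  have huniq : (∀ i j, i ≠ j → LinearIndependent ℂ ![s i, s j]) → ∀ ω, blockKRank G = K →
      blockKRank (A ω) = K → IsEssentiallyUniqueBTD G (A ω) So (Y ω) := fun hind ω hG hA =>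
    isEssentiallyUniqueBTD_of_linearIndependent hL ((blockKRank_eq_iff G).1 hG)
      ((blockKRank_eq_iff (A ω)).1 hA) hs hind (hblock ω)
  refine ⟨hpath, hblock, ?_, ?_, ?_⟩
  · rintro ⟨k, hk⟩
    let x : Σ k, Fin (L k) := ⟨k, ⟨0, by omega⟩⟩
    let y : Σ k, Fin (L k) := ⟨k, ⟨1, by omega⟩⟩
    have hxy : x ≠ y := by simp [x, y]
    have hSxy : S.col x = S.col y := by rw [hScol, hScol]
    have hkS : kRank S = 1 := kRank_eq_one S hS0 hxy hSxy
    refine ⟨fun k i j => (hScol ⟨k, i⟩).trans (hScol ⟨k, j⟩).symm, hkS, fun ω => ?_,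
      fun hP hM ω => ?_⟩
    · have h1 := kRank_le_card G
      have h2 := kRank_le_card (A ω)
      rw [hcard] at h1 h2
      omega
    · refine not_cpdUnique (fun l h0 => ?_) hS0 hM (hpath ω) hxy hSxy
      exact Complex.exp_ne_zero _ (congrFun h0 ⟨0, hP⟩)
  · intro _ hind
    have hkSo : 2 ≤ K → 2 ≤ kRank So := fun hK => two_le_kRank So (by simpa using hK) hind
    refine ⟨hkSo, fun _ => ⟨fun ω hG hA => ⟨fun hK => ?_, huniq hind ω hG hA⟩, fun h => ?_⟩⟩
    · have := hkSo hK
      omega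
    · filter_upwards [h] with ω hω
      exact huniq hind ω hω.1 hω.2
  · intro hP hM hτ hgain hst
    have hG : blockKRank G = K :=
      (blockKRank_eq_iff G).2 (linearIndependent_col_delayMatrix sys path hP hτ)
    have hA : ∀ᵐ ω ∂μ, blockKRank (A ω) = K := by
      filter_upwards [ae_linearIndependent_col_spatialMatrix sys path hΦm hΦu hΦi hM hgain hst]
        with ω hω
      exact (blockKRank_eq_iff (A ω)).2 hω
    refine ⟨?_, hG, hA, fun _ hind => ?_⟩
    · calc ∑ k, L k ^ 2 ≤ (∑ k, L k) ^ 2 := Finset.sum_sq_le_sq_sum_of_nonneg fun _ _ => Nat.zero_le _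
        _ = (∑ k, L k) * ∑ k, L k := sq _
        _ ≤ P * M := Nat.mul_le_mul hP hM
    · filter_upwards [hA] with ω hω
      exact huniq hind ω hG hω
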